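/- Let $\mathbb H$ be the quaternions, $n\ge 1$, and write $x=(x_1,\dots,x_n)\in\mathbb H^n$ with $x_m=x_{m0}+ix_{m1}+jx_{m2}+kx_{m3}$ and $\operatorname{Im}(x_m)=ix_{m1}+jx_{m2}+kx_{m3}$. Let $\mathbb R_\bullet$ be the set of $x\in\mathbb H^n$ having at least one real coordinate $x_k$. For $m\in\{1,\dots,n\}$ put $$\vartheta_{x_m}=\tfrac12\Big(\tfrac{\partial}{\partial x_{m0}}+\operatorname{Im}(x_m)^{-1}\sum_{a=1}^3x_{ma}\tfrac{\partial}{\partial x_{ma}}\Big),\qquad \overline\vartheta_{x_m}=\tfrac12\Big(\tfrac{\partial}{\partial x_{m0}}-\operatorname{Im}(x_m)^{-1}\sum_{a=1}^3x_{ma}\tfrac{\partial}{\partial x_{ma}}\Big),$$ $$\Gamma_{x_m}=-iL^m_{23}+jL^m_{13}-kL^m_{12},\qquad L^m_{ab}=x_{ma}\tfrac{\partial}{\partial x_{mb}}-x_{mb}\tfrac{\partial}{\partial x_{ma}}.$$ For a function $f$ of class $C^n$ on $\mathbb H^n\setminus\mathbb R_\bullet$, let $\Gamma^0_\emptyset(f)=f$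 and, for $1\le p\le n$ and $K\subseteq\{1,\dots,p\}$, $$\Gamma^p_K(f)=(2\operatorname{Im}(x_p))^{-1}\,\Gamma_{x_p}\big(x_p^{\mathbf 1_K(p)}\,\Gamma^{p-1}_{K\setminus\{p\}}(f)\big).$$ The quaternionic Wirtinger operators are $$\theta_m(f)=\sum_{K\subseteq\{1,\dots,m-1\}}(-\overline x)_{K^c}\,\vartheta_{x_m}\Gamma^{m-1}_K(f),\qquad \overline\theta_m(f)=\sum_{K\subseteq\{1,\dots,m-1\}}(-\overline x)_{K^c}\,\overline\vartheta_{x_m}\Gamma^{m-1}_K(f),$$ where $K^c=\{1,\dots,m-1\}\setminus K$ and $(-\overline x)_{H}=(-\overline x_{h_1})\cdots(-\overline x_{h_p})$ for $H=\{h_1<\dots<h_p\}$. A stem function on $\mathbb C^n$ is a map $F=\sum_{K\subseteq\{1,\dots,n\}}e_KF_K:\mathbb C^n\to\mathbb H\otimes\mathbb R^{2^n}$ with $F_K(z_1,\dots,\overline{z_h},\dots,z_n)=F_K(z)$ if $h\notin K$ and $=-F_K(z)$ if $h\in K$. It induces the slice function $f=\mathcal I(F):\mathbb H^n\to\mathbb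 H$, $f(\alpha_1+J_1\beta_1,\dots,\alpha_n+J_n\beta_n)=\sum_KJ_KF_K(\alpha+i\beta)$ for all $\alpha,\beta\in\mathbb R^n$ and all imaginary units $J_1,\dots,J_n$, where $J_K=J_{k_1}\cdots J_{k_p}$ for $K=\{k_1<\dots<k_p\}$; $F$ is determined by $f$. Let $\mathcal J_h(e_K)=e_{K\cup\{h\}}$ if $h\notin K$ and $\mathcal J_h(e_K)=-e_{K\setminus\{h\}}$ if $h\in K$. If $F$ is of class $C^1$, the slice partial derivatives of $f=\mathcal I(F)$ are $$\frac{\partial f}{\partial x_h}=\mathcal I\Big(\tfrac12\big(\tfrac{\partial F}{\partial\alpha_h}-\mathcal J_h\tfrac{\partial F}{\partial\beta_h}\big)\Big),\qquad \frac{\partial f}{\partial x_h^c}=\mathcal I\Big(\tfrac12\big(\tfrac{\partial F}{\partial\alpha_h}+\mathcal J_h\tfrac{\partial F}{\partial\beta_h}\big)\Big).$$ For $\ell=(\ell_1,\dots,\ell_n)\in\mathbb N^n$ let $x^\ell=x_1^{\ell_1}\cdots x_n^{\ell_n}$ and $\overline x^\ell=\overline x_1^{\ell_1}\cdots\overline x_n^{\ell_n}$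 (ordered products), and let $e_m\in\mathbb N^n$ be the multiindex with $1$ in position $m$ and $0$ elsewhere. **Proposition.** For every $\ell\in\mathbb N^n$ and $m\in\{1,\dots,n\}$, the functions $x^\ell$ and $\overline x^\ell$ are slice functions on $\mathbb H^n$ induced by $C^1$ stem functions, and $$\theta_m(x^\ell)=\frac{\partial x^\ell}{\partial x_m}=\ell_m x^{\ell-e_m},\qquad \overline\theta_m(x^\ell)=\frac{\partial x^\ell}{\partial x_m^c}=0,$$ $$\theta_m(\overline x^\ell)=\frac{\partial\overline x^\ell}{\partial x_m}=0,\qquad \overline\theta_m(\overline x^\ell)=\frac{\partial\overline x^\ell}{\partial x_m^c}=\ell_m\overline x^{\ell-e_m},$$ where the values of $\theta_m$ and $\overline\theta_m$ are taken on $\mathbb H^n\setminus\mathbb R_\bullet$, the slice partial derivatives are computed on all of $\mathbb H^n$, and the right-hand sides with factor $\ell_m$ are read as $0$ if $\ell_m=0$. -/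

import Mathlib

open scoped Quaternion

noncomputable section

namespace QWirtinger

/-- The standard imaginary units of the real quaternions. -/
def qi : ℍ[ℝ] := ⟨0, 1, 0, 0⟩
def qj : ℍ[ℝ] := ⟨0, 0, 1, 0⟩
def qk : ℍ[ℝ] := ⟨0, 0, 0, 1⟩

variable {n : ℕ}

/-- Partial derivative of `f : ℍⁿ → ℍ` along the direction `u` of the `m`-th quaternionic variable;
`u = 1, qi, qj, qk` gives the derivatives with respect to the four real coordinates of `x m`. -/
def pd (m : Fin n) (u : ℍ[ℝ]) (f : (Fin n → ℍ[ℝ]) → ℍ[ℝ]) (x : Fin n → ℍ[ℝ]) : ℍ[ℝ] :=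
  lineDeriv ℝ f x (Pi.single m u)

/-- Euler operator with respect to the imaginary part of `x m`. -/
def euler (m : Fin n) (f : (Fin n → ℍ[ℝ]) → ℍ[ℝ]) (x : Fin n → ℍ[ℝ]) : ℍ[ℝ] :=
  (x m).imI • pd m qi f x + (x m).imJ • pd m qj f x + (x m).imK • pd m qk f x

/-- The global operator `½ (∂/∂x₀ + Im(x)⁻¹ E)` in the variable `x m`. -/
def globalD (m : Fin n) (f : (Fin n → ℍ[ℝ]) → ℍ[ℝ]) (x : Fin n → ℍ[ℝ]) : ℍ[ℝ] :=
  (1 / 2 : ℝ) • (pd m 1 f x + (x m).im⁻¹ * euler m f x)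

/-- The global operator `½ (∂/∂x₀ - Im(x)⁻¹ E)` in the variable `x m`. -/
def globalDBar (m : Fin n) (f : (Fin n → ℍ[ℝ]) → ℍ[ℝ]) (x : Fin n → ℍ[ℝ]) : ℍ[ℝ] :=
  (1 / 2 : ℝ) • (pd m 1 f x - (x m).im⁻¹ * euler m f x)

/-- Spherical Dirac operator `-i L₂₃ + j L₁₃ - k L₁₂` in the variable `x m`, where
`L_{ab} = x_a ∂/∂x_b - x_b ∂/∂x_a`. -/
def sphericalDirac (m : Fin n) (f : (Fin n → ℍ[ℝ]) → ℍ[ℝ]) (x : Fin n → ℍ[ℝ]) : ℍ[ℝ] :=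
  -(qi * ((x m).imJ • pd m qk f x - (x m).imK • pd m qj f x))
    + qj * ((x m).imI • pd m qk f x - (x m).imK • pd m qi f x)
    - qk * ((x m).imI • pd m qj f x - (x m).imJ • pd m qi f x)

/-- The iterated operators `Γ^p_K`, for `0 ≤ p ≤ n` and a set `K` of indices among the first `p`.
The variable treated in step `p + 1` has index `p` in `Fin n`. (For `p > n` the value is junk.) -/
def iterGamma : ℕ → Finset (Fin n) → ((Fin n → ℍ[ℝ]) → ℍ[ℝ]) → (Fin n → ℍ[ℝ]) → ℍ[ℝ]
  | 0, _, f => f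
  | p + 1, K, f =>
    if h : p < n then
      fun x => (2 * (x ⟨p, h⟩).im)⁻¹ *
        sphericalDirac ⟨p, h⟩
          (fun y => y ⟨p, h⟩ ^ (if (⟨p, h⟩ : Fin n) ∈ K then 1 else 0)
            * iterGamma p (K.erase ⟨p, h⟩) f y) x
    else 0

/-- The product of the `a k` over `k ∈ K`, in increasing order of the index. -/
def orderedProd (K : Finset (Fin n)) (a : Fin n → ℍ[ℝ]) : ℍ[ℝ] :=
  (List.ofFn fun k => if k ∈ K then a k else 1).prod

/-- The Wirtinger operator `θ_m`. The subsets of `{1, …, m-1}` are those of `Finset.Iio m`. -/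
def theta (m : Fin n) (f : (Fin n → ℍ[ℝ]) → ℍ[ℝ]) (x : Fin n → ℍ[ℝ]) : ℍ[ℝ] :=
  ∑ K ∈ (Finset.Iio m).powerset,
    orderedProd (Finset.Iio m \ K) (fun k => -star (x k)) * globalD m (iterGamma (m : ℕ) K f) x

/-- The conjugate Wirtinger operator `θ̄_m`. -/
def thetaBar (m : Fin n) (f : (Fin n → ℍ[ℝ]) → ℍ[ℝ]) (x : Fin n → ℍ[ℝ]) : ℍ[ℝ] :=
  ∑ K ∈ (Finset.Iio m).powerset,
    orderedProd (Finset.Iio m \ K) (fun k => -star (x k)) * globalDBar m (iterGamma (m : ℕ) K f) x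

/-- `F = ∑ e_K F_K : ℂⁿ → ℍ ⊗ ℝ^(2ⁿ)`, given by its components `F_K`, is a stem function. -/
def IsStem (F : (Fin n → ℂ) → Finset (Fin n) → ℍ[ℝ]) : Prop :=
  ∀ (z : Fin n → ℂ) (K : Finset (Fin n)) (h : Fin n),
    F (Function.update z h (star (z h))) K = if h ∈ K then -F z K else F z K

/-- `f : ℍⁿ → ℍ` is the slice function induced by `F`:
`f(α₁ + J₁β₁, …, αₙ + Jₙβₙ) = ∑ J_K F_K(α + iβ)` for all imaginary units `J₁, …, Jₙ`. -/
def Induces (F : (Fin n → ℂ) → Finset (Fin n) → ℍ[ℝ]) (f : (Fin n → ℍ[ℝ]) → ℍ[ℝ]) : Prop :=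
  ∀ (z : Fin n → ℂ) (J : Fin n → ℍ[ℝ]), (∀ k, J k * J k = -1) →
    f (fun k => ((z k).re : ℍ[ℝ]) + J k * ((z k).im : ℍ[ℝ])) = ∑ K, orderedProd K J * F z K

/-- The complex structure `e_K ↦ e_{K ∪ {h}}` (`h ∉ K`), `e_K ↦ -e_{K \ {h}}` (`h ∈ K`),
in components. -/
def cstruct (h : Fin n) (a : Finset (Fin n) → ℍ[ℝ]) : Finset (Fin n) → ℍ[ℝ] :=
  fun K => if h ∈ K then a (K.erase h) else -a (insert h K)

/-- The Cauchy-Riemann operator `∂_h = ½ (∂/∂α_h - 𝒥_h ∂/∂β_h)`. -/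
def stemD (h : Fin n) (F : (Fin n → ℂ) → Finset (Fin n) → ℍ[ℝ]) (z : Fin n → ℂ) :
    Finset (Fin n) → ℍ[ℝ] :=
  (1 / 2 : ℝ) • (lineDeriv ℝ F z (Pi.single h 1)
    - cstruct h (lineDeriv ℝ F z (Pi.single h Complex.I)))

/-- The Cauchy-Riemann operator `∂̄_h = ½ (∂/∂α_h + 𝒥_h ∂/∂β_h)`. -/
def stemDBar (h : Fin n) (F : (Fin n → ℂ) → Finset (Fin n) → ℍ[ℝ]) (z : Fin n → ℂ) :
    Finset (Fin n) → ℍ[ℝ] :=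
  (1 / 2 : ℝ) • (lineDeriv ℝ F z (Pi.single h 1)
    + cstruct h (lineDeriv ℝ F z (Pi.single h Complex.I)))

/-- `f` is a slice function on `ℍⁿ` induced by a stem function of class `C¹`, and its slice partial
derivative `∂f/∂x_h` is `g`. (The inducing stem function is unique; the clause is required of
every one, so no choice is involved.) -/
def HasSlicePD (h : Fin n) (f g : (Fin n → ℍ[ℝ]) → ℍ[ℝ]) : Prop :=
  (∃ F, IsStem F ∧ ContDiff ℝ 1 F ∧ Induces F f) ∧
    ∀ F, IsStem F → ContDiff ℝ 1 F → Induces F f → Induces (stemD h F) g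

/-- The same for the slice partial derivative `∂f/∂x_h^c`. -/
def HasSlicePDConj (h : Fin n) (f g : (Fin n → ℍ[ℝ]) → ℍ[ℝ]) : Prop :=
  (∃ F, IsStem F ∧ ContDiff ℝ 1 F ∧ Induces F f) ∧
    ∀ F, IsStem F → ContDiff ℝ 1 F → Induces F f → Induces (stemDBar h F) g

/-- The ordered monomial `x₁^ℓ₁ ⋯ xₙ^ℓₙ`. -/
def monom (l : Fin n → ℕ) (x : Fin n → ℍ[ℝ]) : ℍ[ℝ] :=
  (List.ofFn fun k => x k ^ l k).prod

/-- The ordered monomial `x̄₁^ℓ₁ ⋯ x̄ₙ^ℓₙ`. -/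
def conjMonom (l : Fin n → ℕ) (x : Fin n → ℍ[ℝ]) : ℍ[ℝ] :=
  (List.ofFn fun k => star (x k) ^ l k).prod

/-- The set `ℍⁿ \ ℝ_•` of the points none of whose coordinates is real. -/
def nonreal (n : ℕ) : Set (Fin n → ℍ[ℝ]) := {x | ∀ k, (x k).im ≠ 0}

end QWirtinger

end

open scoped Quaternion

noncomputable section

namespace QWirtinger

variable {n : ℕ}

/-! ### Ordered products -/

/-! Both monomials are ordered products `g₁(x₁) ⋯ gₙ(xₙ)` of one-variable slice functions `g = U + V
Im x` with `U`, `V` real functions of `x₀` and `|Im x|²`. The operator `(2 Im x)⁻¹ Γ` sends `g` to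
`V` and `x g` to `U + x₀ V`, both real. Hence `Γ^p_K` makes the first `p` factors real
(`iterGamma_oprod`), so the next factor can be pulled to the far left, where left-linear operators
see it alone. In `θ_m`, multilinearity of the ordered product turns the sum over `K` into a product
whose factor at each `k < m` is `(U + x₀ V) - x̄ V = U + V Im x = g_k`. The first `m - 1` factors
are thus restored, and only the `m`-th is hit by the one-variable operator
(`sum_orderedProd_mul_oprod`). For powers that operator is computed directly, since `1` and `Im x`
commute with `x`. On the slice side the inducing stem function is unique (`Induces.unique`), so it
is the product of the one-variable stem functions `z ^ l` or `z̄ ^ l`. As `𝒥_m` is multiplication by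
`i` in the `m`-th factor, the slice derivatives reduce to the complex Wirtinger derivatives of that
factor (`stemD_prodStem`, `stemDBar_prodStem`). -/

theorem ofFn_prod_mul_ofFn_prod {M : Type*} [Monoid M] :
    ∀ {n : ℕ} (a b : Fin n → M), (∀ i j, i < j → Commute (a j) (b i)) →
      (List.ofFn a).prod * (List.ofFn b).prod = (List.ofFn fun k => a k * b k).prod
  | 0, a, b, _ => by simp
  | n + 1, a, b, h => by
    have ih := ofFn_prod_mul_ofFn_prod (fun i : Fin n => a i.succ) (fun i => b i.succ)
      fun i j hij => h _ _ (Fin.succ_lt_succ_iff.2 hij)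
    have hc : Commute (List.ofFn fun i : Fin n => a i.succ).prod (b 0) := by
      apply Commute.list_prod_left
      intro y hy
      obtain ⟨i, rfl⟩ := (List.mem_ofFn' _ _).1 hy
      exact h _ _ (Fin.succ_pos i)
    simp only [List.ofFn_succ, List.prod_cons]
    rw [← ih, mul_assoc, ← mul_assoc _ (b 0), hc.eq]
    simp only [mul_assoc]

theorem coe_eq_smul_one (r : ℝ) : (r : ℍ[ℝ]) = r • 1 := Algebra.algebraMap_eq_smul_one r

/-- The ordered product of `n` quaternions, as a multilinear map. -/
def oprod (n : ℕ) : MultilinearMap ℝ (fun _ : Fin n => ℍ[ℝ]) ℍ[ℝ] :=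
  MultilinearMap.mkPiAlgebraFin ℝ n ℍ[ℝ]

theorem oprod_apply (a : Fin n → ℍ[ℝ]) : oprod n a = (List.ofFn a).prod :=
  MultilinearMap.mkPiAlgebraFin_apply _

theorem oprod_mul (a b : Fin n → ℍ[ℝ]) (h : ∀ i j, i < j → Commute (a j) (b i)) :
    oprod n a * oprod n b = oprod n fun k => a k * b k := by
  simp only [oprod_apply, ofFn_prod_mul_ofFn_prod a b h]

theorem oprod_coe (r : Fin n → ℝ) : oprod n (fun k => (r k : ℍ[ℝ])) = ((∏ k, r k : ℝ) : ℍ[ℝ]) := by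
  have h := (oprod n).map_smul_univ r (fun _ => 1)
  have h1 : oprod n (fun _ => 1) = 1 := by simp [oprod_apply]
  simpa only [h1, ← coe_eq_smul_one] using h

theorem oprod_single (p : Fin n) (q : ℍ[ℝ]) : oprod n (Function.update 1 p q) = q := by
  rw [oprod_apply]
  induction n with
  | zero => exact p.elim0
  | succ n ih =>
    refine Fin.cases ?_ (fun p => ?_) p
    · simp [List.ofFn_succ]
    · have h : (fun i : Fin n => Function.update (1 : Fin (n + 1) → ℍ[ℝ]) p.succ q i.succ)
          = Function.update (1 : Fin n → ℍ[ℝ]) p q := by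
        ext1 i
        by_cases hi : i = p <;> simp [hi]
      simp only [List.ofFn_succ, List.prod_cons]
      rw [h, ih]
      simp [(Fin.succ_ne_zero _).symm]

theorem commute_of_eq_coe {a : ℍ[ℝ]} {r : ℝ} (h : a = r) (q : ℍ[ℝ]) : Commute q a :=
  h ▸ (Quaternion.coe_commute r q).symm

/-- A factor can be moved from the left of an ordered product past real factors. -/
theorem mul_oprod_update (a : Fin n → ℍ[ℝ]) (p : Fin n) (h : ∀ k < p, ∃ r : ℝ, a k = r)
    (q y : ℍ[ℝ]) :
    q * oprod n (Function.update a p y) = oprod n (Function.update a p (q * y)) := by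
  conv_lhs => rw [← oprod_single p q]
  rw [oprod_mul]
  · congr 1
    ext1 k
    by_cases hk : k = p
    · subst hk; simp
    · simp [hk]
  · intro i j hij
    by_cases hj : j = p
    · subst hj
      obtain ⟨r, hr⟩ := h i hij
      rw [Function.update_of_ne hij.ne]
      exact commute_of_eq_coe hr _
    · simp [hj]

theorem oprod_update_eq (a : Fin n → ℍ[ℝ]) (p : Fin n) (h : ∀ k < p, ∃ r : ℝ, a k = r)
    (y : ℍ[ℝ]) : oprod n (Function.update a p y) = y * oprod n (Function.update a p 1) := by
  rw [mul_oprod_update a p h, mul_one]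

theorem orderedProd_eq (K : Finset (Fin n)) (a : Fin n → ℍ[ℝ]) :
    orderedProd K a = oprod n fun k => if k ∈ K then a k else 1 :=
  (oprod_apply _).symm

theorem sum_oprod_ite (a b : Fin n → ℍ[ℝ]) :
    ∑ K : Finset (Fin n), oprod n (fun k => if k ∈ K then a k else b k)
      = oprod n fun k => a k + b k :=
  ((oprod n).map_add_univ a b).symm

/-- In the full expansion over all `K`, a set not contained in `S` contributes a product with a zero
factor. -/
theorem sum_powerset_oprod_ite (S : Finset (Fin n)) (a b : Fin n → ℍ[ℝ]) (ha : ∀ k ∉ S, a k = 0) :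
    ∑ K ∈ S.powerset, oprod n (fun k => if k ∈ K then a k else b k)
      = oprod n fun k => a k + b k := by
  rw [← sum_oprod_ite]
  refine Finset.sum_subset (Finset.subset_univ _) fun K _ hK => ?_
  obtain ⟨k, hk, hkS⟩ := Finset.not_subset.1 (mt Finset.mem_powerset.2 hK)
  exact (oprod n).map_coord_zero k (by simp [hk, ha k hkS])

/-! ### Slice functions of one variable -/

/-- The pair `(x₀, |Im x|²)`. -/
def radii (x : ℍ[ℝ]) : ℝ × ℝ := (x.re, x.imI ^ 2 + x.imJ ^ 2 + x.imK ^ 2)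

@[simp] theorem radii_fst (x : ℍ[ℝ]) : (radii x).1 = x.re := rfl

theorem radii_snd (x : ℍ[ℝ]) : (radii x).2 = x.imI ^ 2 + x.imJ ^ 2 + x.imK ^ 2 := rfl

/-- The slice function `x ↦ U(x₀, |Im x|²) + V(x₀, |Im x|²) Im x`. -/
def sliceFn (U V : ℝ × ℝ → ℝ) (x : ℍ[ℝ]) : ℍ[ℝ] :=
  (U (radii x) : ℍ[ℝ]) + V (radii x) • x.im

/-- `g` is the slice function with differentiable real components `U` and `V`. -/
structure IsSliceFn (U V : ℝ × ℝ → ℝ) (g : ℍ[ℝ] → ℍ[ℝ]) : Prop where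
  diffU : Differentiable ℝ U
  diffV : Differentiable ℝ V
  eq : ∀ x, g x = sliceFn U V x

/-- Uses `(Im x)² = -|Im x|²`. The new second component `U + x₀ V` is the real factor that `Γ^p_K`
produces at the indices in `K`. -/
theorem IsSliceFn.mul_left {U V : ℝ × ℝ → ℝ} {g : ℍ[ℝ] → ℍ[ℝ]} (h : IsSliceFn U V g) :
    IsSliceFn (fun t => t.1 * U t - t.2 * V t) (fun t => U t + t.1 * V t) (fun x => x * g x) where
  diffU := by have := h.diffU; have := h.diffV; fun_prop
  diffV := by have := h.diffU; have := h.diffV; fun_prop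
  eq x := by
    rw [h.eq]
    ext <;> simp [sliceFn] <;> (try simp only [radii_snd]) <;> ring

theorem IsSliceFn.star_mul {U V : ℝ × ℝ → ℝ} {g : ℍ[ℝ] → ℍ[ℝ]} (h : IsSliceFn U V g) :
    IsSliceFn (fun t => t.1 * U t + t.2 * V t) (fun t => t.1 * V t - U t)
      (fun x => star x * g x) where
  diffU := by have := h.diffU; have := h.diffV; fun_prop
  diffV := by have := h.diffU; have := h.diffV; fun_prop
  eq x := by
    rw [h.eq]
    ext <;> simp [sliceFn] <;> (try simp only [radii_snd]) <;> ring

theorem exists_isSliceFn_pow (l : ℕ) : ∃ U V, IsSliceFn U V fun x => x ^ l := by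
  induction l with
  | zero => exact ⟨fun _ => 1, fun _ => 0, by fun_prop, by fun_prop, fun x => by simp [sliceFn]⟩
  | succ l ih =>
    obtain ⟨U, V, h⟩ := ih
    simp only [pow_succ']
    exact ⟨_, _, h.mul_left⟩

theorem exists_isSliceFn_star_pow (l : ℕ) : ∃ U V, IsSliceFn U V fun x => star x ^ l := by
  induction l with
  | zero => exact ⟨fun _ => 1, fun _ => 0, by fun_prop, by fun_prop, fun x => by simp [sliceFn]⟩
  | succ l ih =>
    obtain ⟨U, V, h⟩ := ih
    simp only [pow_succ']
    exact ⟨_, _, h.star_mul⟩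

/-- The real coordinates of a quaternion, as continuous linear maps. -/
def coordL (i : Fin 4) : ℍ[ℝ] →L[ℝ] ℝ :=
  LinearMap.toContinuousLinearMap
    { toFun := fun x => ![x.re, x.imI, x.imJ, x.imK] i
      map_add' := fun x y => by fin_cases i <;> simp
      map_smul' := fun c x => by fin_cases i <;> simp }

/-- The imaginary part as a continuous linear map. -/
def imL : ℍ[ℝ] →L[ℝ] ℍ[ℝ] :=
  LinearMap.toContinuousLinearMap
    { toFun := fun x => x.im
      map_add' := fun x y => by ext <;> simp
      map_smul' := fun c x => by ext <;> simp }

/-- The vectors `w` are those tangent to the sphere of fixed `x₀` and `|Im x|`; along them `radii`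
is constant to first order. -/
theorem hasFDerivAt_radial {U : ℝ × ℝ → ℝ} (hU : Differentiable ℝ U) (x : ℍ[ℝ]) :
    ∃ U' : ℍ[ℝ] →L[ℝ] ℝ,
      HasFDerivAt (fun x : ℍ[ℝ] => U (radii x)) U' x ∧
      ∀ w : ℍ[ℝ], w.re = 0 → x.imI * w.imI + x.imJ * w.imJ + x.imK * w.imK = 0 → U' w = 0 := by
  have h0 : HasFDerivAt (fun x : ℍ[ℝ] => x.re) (coordL 0) x := (coordL 0).hasFDerivAt
  have h1 : HasFDerivAt (fun x : ℍ[ℝ] => x.imI) (coordL 1) x := (coordL 1).hasFDerivAt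
  have h2 : HasFDerivAt (fun x : ℍ[ℝ] => x.imJ) (coordL 2) x := (coordL 2).hasFDerivAt
  have h3 : HasFDerivAt (fun x : ℍ[ℝ] => x.imK) (coordL 3) x := (coordL 3).hasFDerivAt
  refine ⟨_, ((hU _).hasFDerivAt).comp x
    (h0.prodMk (((h1.pow 2).add (h2.pow 2)).add (h3.pow 2))), fun w hw hxw => ?_⟩
  have e0 : coordL 0 w = 0 := hw
  have e1 : coordL 1 w = w.imI := rfl
  have e2 : coordL 2 w = w.imJ := rfl
  have e3 : coordL 3 w = w.imK := rfl
  rw [ContinuousLinearMap.comp_apply]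
  convert map_zero (fderiv ℝ U (radii x))
  ext
  · exact e0
  · simp [e1, e2, e3]
    linear_combination 2 * hxw

theorem IsSliceFn.hasFDerivAt {U V : ℝ × ℝ → ℝ} {g : ℍ[ℝ] → ℍ[ℝ]} (h : IsSliceFn U V g)
    (x : ℍ[ℝ]) :
    ∃ g' : ℍ[ℝ] →L[ℝ] ℍ[ℝ], HasFDerivAt g g' x ∧
      ∀ w : ℍ[ℝ], w.re = 0 → x.imI * w.imI + x.imJ * w.imJ + x.imK * w.imK = 0 →
        g' w = V (radii x) • w := by
  obtain ⟨U', hU, hU0⟩ := hasFDerivAt_radial h.diffU x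
  obtain ⟨V', hV, hV0⟩ := hasFDerivAt_radial h.diffV x
  have hI : HasFDerivAt (fun x : ℍ[ℝ] => x.im) imL x := imL.hasFDerivAt
  have hg : g = fun x => U (radii x) • (1 : ℍ[ℝ])
      + V (radii x) • x.im := by
    funext x
    rw [h.eq, sliceFn, coe_eq_smul_one]
  rw [hg]
  refine ⟨_, (hU.smul_const 1).add (hV.smul hI), fun w hw hxw => ?_⟩
  have e : imL w = w := by
    change w.im = w
    ext <;> simp [hw]
  simp [hU0 w hw hxw, hV0 w hw hxw, e]

/-! ### Operators acting on functions that factor through one variable -/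

@[simp] theorem qi_re : qi.re = 0 := rfl
@[simp] theorem qi_imI : qi.imI = 1 := rfl
@[simp] theorem qi_imJ : qi.imJ = 0 := rfl
@[simp] theorem qi_imK : qi.imK = 0 := rfl
@[simp] theorem qj_re : qj.re = 0 := rfl
@[simp] theorem qj_imI : qj.imI = 0 := rfl
@[simp] theorem qj_imJ : qj.imJ = 1 := rfl
@[simp] theorem qj_imK : qj.imK = 0 := rfl
@[simp] theorem qk_re : qk.re = 0 := rfl
@[simp] theorem qk_imI : qk.imI = 0 := rfl
@[simp] theorem qk_imJ : qk.imJ = 0 := rfl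
@[simp] theorem qk_imK : qk.imK = 1 := rfl

theorem add_smul_single (x : Fin n → ℍ[ℝ]) (p : Fin n) (t : ℝ) (u : ℍ[ℝ]) :
    x + t • (Pi.single p u : Fin n → ℍ[ℝ]) = Function.update x p (x p + t • u) := by
  ext1 k
  by_cases hk : k = p
  · subst hk; simp
  · simp [hk]

/-- Only the restriction to the `p`-th variable matters; the constant right factor `B` then passes
through every operator that multiplies on the left. -/
theorem pd_of_eq {p : Fin n} {f : (Fin n → ℍ[ℝ]) → ℍ[ℝ]} {x : Fin n → ℍ[ℝ]} {G : ℍ[ℝ] → ℍ[ℝ]}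
    {G' : ℍ[ℝ] →L[ℝ] ℍ[ℝ]} {B : ℍ[ℝ]} (hf : ∀ y, f (Function.update x p y) = G y * B)
    (hG : HasFDerivAt G G' (x p)) (u : ℍ[ℝ]) : pd p u f x = G' u * B := by
  have h : HasDerivAt (fun t : ℝ => G (x p + t • u)) (G' u) 0 := by
    have h1 : HasDerivAt (fun t : ℝ => x p + t • u) u 0 := by
      simpa using ((hasDerivAt_id (0 : ℝ)).smul_const u).const_add (x p)
    exact HasFDerivAt.comp_hasDerivAt (0 : ℝ) (by simpa using hG) h1
  have h2 : (fun t : ℝ => f (x + t • (Pi.single p u : Fin n → ℍ[ℝ]))) = fun t => G (x p + t • u) * B := by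
    funext t
    rw [add_smul_single, hf]
  rw [pd, lineDeriv, h2]
  exact (h.mul_const B).deriv

theorem euler_of_eq {p : Fin n} {f : (Fin n → ℍ[ℝ]) → ℍ[ℝ]} {x : Fin n → ℍ[ℝ]}
    {G : ℍ[ℝ] → ℍ[ℝ]} {G' : ℍ[ℝ] →L[ℝ] ℍ[ℝ]} {B : ℍ[ℝ]}
    (hf : ∀ y, f (Function.update x p y) = G y * B) (hG : HasFDerivAt G G' (x p)) :
    euler p f x = G' (x p).im * B := by
  have e : (x p).im = (x p).imI • qi + (x p).imJ • qj + (x p).imK • qk := by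
    ext <;> simp
  rw [e]
  simp only [euler, pd_of_eq hf hG, map_add, map_smul, add_mul, smul_mul_assoc]

theorem globalD_of_eq {p : Fin n} {f : (Fin n → ℍ[ℝ]) → ℍ[ℝ]} {x : Fin n → ℍ[ℝ]}
    {G : ℍ[ℝ] → ℍ[ℝ]} {G' : ℍ[ℝ] →L[ℝ] ℍ[ℝ]} {B : ℍ[ℝ]}
    (hf : ∀ y, f (Function.update x p y) = G y * B) (hG : HasFDerivAt G G' (x p)) :
    globalD p f x = ((1 / 2 : ℝ) • (G' 1 + (x p).im⁻¹ * G' (x p).im)) * B := by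
  rw [globalD, euler_of_eq hf hG, pd_of_eq hf hG, smul_mul_assoc, add_mul, mul_assoc]

theorem globalDBar_of_eq {p : Fin n} {f : (Fin n → ℍ[ℝ]) → ℍ[ℝ]} {x : Fin n → ℍ[ℝ]}
    {G : ℍ[ℝ] → ℍ[ℝ]} {G' : ℍ[ℝ] →L[ℝ] ℍ[ℝ]} {B : ℍ[ℝ]}
    (hf : ∀ y, f (Function.update x p y) = G y * B) (hG : HasFDerivAt G G' (x p)) :
    globalDBar p f x = ((1 / 2 : ℝ) • (G' 1 - (x p).im⁻¹ * G' (x p).im)) * B := by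
  rw [globalDBar, euler_of_eq hf hG, pd_of_eq hf hG, smul_mul_assoc, sub_mul, mul_assoc]

/-- Each `L_{ab}` differentiates along a tangent vector of the sphere, where `G'` is multiplication
by the real number `V`. What remains is the identity `-i(x₂k - x₃j) + j(x₁k - x₃i) - k(x₁j - x₂i) =
2 Im x`. -/
theorem sphericalDirac_of_eq {p : Fin n} {f : (Fin n → ℍ[ℝ]) → ℍ[ℝ]} {x : Fin n → ℍ[ℝ]}
    {G : ℍ[ℝ] → ℍ[ℝ]} {U V : ℝ × ℝ → ℝ} {B : ℍ[ℝ]}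
    (hf : ∀ y, f (Function.update x p y) = G y * B) (hG : IsSliceFn U V G) :
    sphericalDirac p f x = 2 * (x p).im * (V (radii (x p)) * B) := by
  obtain ⟨G', hG', h0⟩ := hG.hasFDerivAt (x p)
  have key (a b : ℝ) (u v : ℍ[ℝ]) : a • pd p u f x - b • pd p v f x = G' (a • u - b • v) * B := by
    simp only [pd_of_eq hf hG', map_sub, map_smul, sub_mul, smul_mul_assoc]
  rw [sphericalDirac, key, key, key, h0, h0, h0]
  · simp only [← mul_assoc, ← neg_mul, ← add_mul, ← sub_mul]
    congr 1
    rw [two_mul]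
    ext <;> simp <;> ring
  all_goals simp <;> ring

theorem inv_mul_sphericalDirac_of_eq {p : Fin n} {f : (Fin n → ℍ[ℝ]) → ℍ[ℝ]} {x : Fin n → ℍ[ℝ]}
    {G : ℍ[ℝ] → ℍ[ℝ]} {U V : ℝ × ℝ → ℝ} {B : ℍ[ℝ]} (hx : (x p).im ≠ 0)
    (hf : ∀ y, f (Function.update x p y) = G y * B) (hG : IsSliceFn U V G) :
    (2 * (x p).im)⁻¹ * sphericalDirac p f x = V (radii (x p)) * B := by
  have h : 2 * (x p).im ≠ 0 := by
    rw [two_mul, ← two_smul ℝ]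
    exact smul_ne_zero two_ne_zero hx
  rw [sphericalDirac_of_eq hf hG, inv_mul_cancel_left₀ h]

/-! ### The iterated operators on ordered products of slice functions -/

section Products

variable {U V : Fin n → ℝ × ℝ → ℝ} {g : Fin n → ℍ[ℝ] → ℍ[ℝ]}

/-- The factors of `Γ^p_K(g₁(x₁) ⋯ gₙ(xₙ))`. -/
def gammaFactor (U V : Fin n → ℝ × ℝ → ℝ) (g : Fin n → ℍ[ℝ] → ℍ[ℝ]) (p : ℕ)
    (K : Finset (Fin n)) (x : Fin n → ℍ[ℝ]) (k : Fin n) : ℍ[ℝ] :=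
  if (k : ℕ) < p then
    if k ∈ K then ((U k (radii (x k)) + (x k).re * V k (radii (x k)) : ℝ) : ℍ[ℝ])
    else (V k (radii (x k)) : ℍ[ℝ])
  else g k (x k)

theorem gammaFactor_real {p : ℕ} {K : Finset (Fin n)} {x : Fin n → ℍ[ℝ]} {k : Fin n}
    (hk : (k : ℕ) < p) : ∃ r : ℝ, gammaFactor U V g p K x k = r := by
  rw [gammaFactor, if_pos hk]
  split_ifs <;> exact ⟨_, rfl⟩

theorem gammaFactor_update (p : Fin n) (K : Finset (Fin n)) (x : Fin n → ℍ[ℝ]) (y : ℍ[ℝ]) :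
    gammaFactor U V g p K (Function.update x p y)
      = Function.update (gammaFactor U V g p K x) p (g p y) := by
  ext1 k
  by_cases hk : k = p
  · subst hk; simp [gammaFactor]
  · simp [gammaFactor, hk]

theorem oprod_gammaFactor_update (p : Fin n) (K : Finset (Fin n)) (x : Fin n → ℍ[ℝ]) (y : ℍ[ℝ]) :
    oprod n (gammaFactor U V g p K (Function.update x p y))
      = g p y * oprod n (Function.update (gammaFactor U V g p K x) p 1) := by
  rw [gammaFactor_update, oprod_update_eq]
  exact fun k hk => gammaFactor_real hk

theorem gammaFactor_succ (p : Fin n) (K : Finset (Fin n)) (x : Fin n → ℍ[ℝ]) :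
    gammaFactor U V g (p + 1) K x
      = Function.update (gammaFactor U V g p (K.erase p) x) p
          (if p ∈ K then ((U p (radii (x p)) + (x p).re * V p (radii (x p)) : ℝ) : ℍ[ℝ])
            else (V p (radii (x p)) : ℍ[ℝ])) := by
  ext1 k
  by_cases hk : k = p
  · subst hk; simp [gammaFactor]
  · have : (k : ℕ) < p + 1 ↔ (k : ℕ) < p := by
      have := Fin.val_ne_of_ne hk
      omega
    simp [gammaFactor, hk, this]

/-- Induction on `p`. Non-reality is asked only of the first `p` coordinates because the induction
hypothesis is applied with the next coordinate replaced by an arbitrary, possibly real, `y`. -/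
theorem iterGamma_oprod (hg : ∀ k, IsSliceFn (U k) (V k) (g k)) (p : ℕ) (hp : p ≤ n)
    (K : Finset (Fin n)) (x : Fin n → ℍ[ℝ]) (hx : ∀ k : Fin n, (k : ℕ) < p → (x k).im ≠ 0) :
    iterGamma p K (fun x => oprod n fun k => g k (x k)) x = oprod n (gammaFactor U V g p K x) := by
  induction p generalizing K x with
  | zero => rw [iterGamma]; congr 1
  | succ p ih =>
    obtain ⟨q, rfl⟩ : ∃ q : Fin n, (q : ℕ) = p := ⟨⟨p, hp⟩, rfl⟩
    have hf (y : ℍ[ℝ]) : iterGamma q (K.erase q) (fun x => oprod n fun k => g k (x k))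
        (Function.update x q y)
          = g q y * oprod n (Function.update (gammaFactor U V g q (K.erase q) x) q 1) := by
      rw [ih q.2.le, oprod_gammaFactor_update]
      intro k hk
      rw [Function.update_of_ne (Fin.ne_of_lt hk)]
      exact hx k (by omega)
    rw [gammaFactor_succ, oprod_update_eq _ _ fun k hk => gammaFactor_real hk]
    simp only [iterGamma, q.2, dif_pos, Fin.eta]
    split_ifs with hK
    · refine inv_mul_sphericalDirac_of_eq (hx q (by simp)) (fun y => ?_) (hg q).mul_left
      simp [hf, mul_assoc]
    · refine inv_mul_sphericalDirac_of_eq (hx q (by simp)) (fun y => ?_) (hg q)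
      simp [hf]

theorem iterGamma_oprod_update (hg : ∀ k, IsSliceFn (U k) (V k) (g k)) (m : Fin n)
    (K : Finset (Fin n)) {x : Fin n → ℍ[ℝ]} (hx : x ∈ nonreal n) (y : ℍ[ℝ]) :
    iterGamma m K (fun x => oprod n fun k => g k (x k)) (Function.update x m y)
      = g m y * oprod n (Function.update (gammaFactor U V g m K x) m 1) := by
  rw [iterGamma_oprod hg _ m.2.le, oprod_gammaFactor_update]
  intro k hk
  rw [Function.update_of_ne (Fin.ne_of_lt hk)]
  exact hx k

/-- For each `k < m` the sum offers the choice between `U + x₀ V` and `-x̄ V`; their sum is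
`g_k(x_k)`. -/
theorem sum_orderedProd_mul_oprod (hg : ∀ k, IsSliceFn (U k) (V k) (g k)) (m : Fin n)
    (x : Fin n → ℍ[ℝ]) (d : ℍ[ℝ]) :
    ∑ K ∈ (Finset.Iio m).powerset, orderedProd (Finset.Iio m \ K) (fun k => -star (x k)) *
        (d * oprod n (Function.update (gammaFactor U V g m K x) m 1))
      = oprod n (Function.update (fun k => g k (x k)) m d) := by
  -- The value `0` for `k ∈ K`, `k ≥ m` never occurs here; it lets the sum over subsets of `Iio m`
  -- be read as a full multilinear expansion.
  have h (K : Finset (Fin n)) (hK : K ∈ (Finset.Iio m).powerset) :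
      orderedProd (Finset.Iio m \ K) (fun k => -star (x k)) *
        (d * oprod n (Function.update (gammaFactor U V g m K x) m 1))
      = oprod n fun k => if k ∈ K then
            (if k < m then ((U k (radii (x k)) + (x k).re * V k (radii (x k)) : ℝ) : ℍ[ℝ]) else 0)
          else if k < m then -star (x k) * (V k (radii (x k)) : ℍ[ℝ])
          else Function.update (fun k => g k (x k)) m d k := by
    rw [← oprod_update_eq _ _ fun k hk => gammaFactor_real hk, orderedProd_eq, oprod_mul]
    · congr 1
      ext1 k
      rcases lt_trichotomy k m with hk | rfl | hk
      · have hk' : (k : ℕ) < m := hk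
        by_cases hkK : k ∈ K <;> simp [hk, hk.ne, hkK, gammaFactor]
      · have hkK : k ∉ K := fun h => by simpa using Finset.mem_powerset.1 hK h
        simp [hkK]
      · have hkK : k ∉ K := fun h => by
          simpa [hk.not_gt] using Finset.mem_powerset.1 hK h
        simp [hkK, hk.not_gt, hk.ne', gammaFactor]
    · intro i j hij
      -- If `j < m`, the right-hand factor at `i < j` is already real; otherwise the left-hand
      -- factor at `j` is `1`.
      by_cases hj : j < m
      · obtain ⟨r, hr⟩ : ∃ r : ℝ, gammaFactor U V g m K x i = r := gammaFactor_real (hij.trans hj)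
        rw [Function.update_of_ne (hij.trans hj).ne]
        exact commute_of_eq_coe hr _
      · simp [hj]
  rw [Finset.sum_congr rfl h, sum_powerset_oprod_ite]
  · congr 1
    ext1 k
    by_cases hk : k < m
    · simp only [if_pos hk, Function.update_of_ne hk.ne, (hg k).eq, sliceFn]
      ext <;> simp <;> ring
    · simp [hk]
  · intro k hk
    simp_all

theorem theta_oprod (hg : ∀ k, IsSliceFn (U k) (V k) (g k)) (m : Fin n) {x : Fin n → ℍ[ℝ]}
    (hx : x ∈ nonreal n) {g' : ℍ[ℝ] →L[ℝ] ℍ[ℝ]} (hg' : HasFDerivAt (g m) g' (x m)) :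
    theta m (fun x => oprod n fun k => g k (x k)) x
      = oprod n (Function.update (fun k => g k (x k)) m
          ((1 / 2 : ℝ) • (g' 1 + (x m).im⁻¹ * g' (x m).im))) := by
  rw [theta, ← sum_orderedProd_mul_oprod hg]
  refine Finset.sum_congr rfl fun K _ => ?_
  rw [globalD_of_eq (iterGamma_oprod_update hg m K hx) hg']

theorem thetaBar_oprod (hg : ∀ k, IsSliceFn (U k) (V k) (g k)) (m : Fin n) {x : Fin n → ℍ[ℝ]}
    (hx : x ∈ nonreal n) {g' : ℍ[ℝ] →L[ℝ] ℍ[ℝ]} (hg' : HasFDerivAt (g m) g' (x m)) :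
    thetaBar m (fun x => oprod n fun k => g k (x k)) x
      = oprod n (Function.update (fun k => g k (x k)) m
          ((1 / 2 : ℝ) • (g' 1 - (x m).im⁻¹ * g' (x m).im))) := by
  rw [thetaBar, ← sum_orderedProd_mul_oprod hg]
  refine Finset.sum_congr rfl fun K _ => ?_
  rw [globalDBar_of_eq (iterGamma_oprod_update hg m K hx) hg']

end Products

/-! ### Powers -/

/-- The commutative formula survives in directions commuting with `x`; `1` and `Im x` are the ones
needed. -/
theorem exists_hasFDerivAt_pow (l : ℕ) (x : ℍ[ℝ]) :
    ∃ g' : ℍ[ℝ] →L[ℝ] ℍ[ℝ], HasFDerivAt (fun x => x ^ l) g' x ∧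
      ∀ w, Commute x w → g' w = (l : ℍ[ℝ]) * x ^ (l - 1) * w := by
  induction l with
  | zero => exact ⟨0, by simpa using hasFDerivAt_const (1 : ℍ[ℝ]) x, by simp⟩
  | succ l ih =>
    obtain ⟨g', h, h'⟩ := ih
    have h2 := (hasFDerivAt_id (𝕜 := ℝ) x).mul' h
    simp only [pow_succ']
    refine ⟨_, h2, fun w hw => ?_⟩
    -- The exponent `l - 1` is truncated, so `x * x ^ (l - 1) = x ^ l` needs `l ≥ 1`.
    rcases l with _ | l
    · simp [h' w hw]
    · have e : w * x ^ (l + 1) = x ^ (l + 1) * w := ((hw.pow_left _).eq).symm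
      have e2 : x * ((l + 1 : ℕ) : ℍ[ℝ]) = ((l + 1 : ℕ) : ℍ[ℝ]) * x := (Nat.cast_commute _ _).symm.eq
      simp [h' w hw, e]
      push_cast at e2
      rw [← mul_assoc, ← mul_assoc, e2, pow_succ' x l]
      noncomm_ring

theorem commute_im (x : ℍ[ℝ]) : Commute x x.im := by
  ext <;> simp <;> ring

theorem exists_hasFDerivAt_pow_euler (l : ℕ) {x : ℍ[ℝ]} (hx : x.im ≠ 0) :
    ∃ g' : ℍ[ℝ] →L[ℝ] ℍ[ℝ], HasFDerivAt (fun x => x ^ l) g' x ∧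
      g' 1 = (l : ℍ[ℝ]) * x ^ (l - 1) ∧ x.im⁻¹ * g' x.im = (l : ℍ[ℝ]) * x ^ (l - 1) := by
  obtain ⟨g', h, h'⟩ := exists_hasFDerivAt_pow l x
  refine ⟨g', h, by simp [h' 1 (Commute.one_right x)], ?_⟩
  rw [h' _ (commute_im x)]
  have hc : Commute ((l : ℍ[ℝ]) * x ^ (l - 1)) x.im :=
    (Nat.cast_commute _ _).mul_left ((commute_im x).pow_left _)
  rw [hc.eq, inv_mul_cancel_left₀ hx]

/-- Quaternionic conjugation as a continuous real-linear map. -/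
def starCLM : ℍ[ℝ] →L[ℝ] ℍ[ℝ] :=
  LinearMap.toContinuousLinearMap
    { toFun := fun x => star x
      map_add' := star_add
      map_smul' := fun c x => by ext <;> simp }

theorem starCLM_apply (x : ℍ[ℝ]) : starCLM x = star x := rfl

/-- Conjugation fixes `1` and negates `Im x`, so the Euler term alone changes sign. -/
theorem exists_hasFDerivAt_star_pow_euler (l : ℕ) {x : ℍ[ℝ]} (hx : x.im ≠ 0) :
    ∃ g' : ℍ[ℝ] →L[ℝ] ℍ[ℝ], HasFDerivAt (fun x => star x ^ l) g' x ∧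
      g' 1 = (l : ℍ[ℝ]) * star x ^ (l - 1) ∧
      x.im⁻¹ * g' x.im = -((l : ℍ[ℝ]) * star x ^ (l - 1)) := by
  have hx' : (star x).im ≠ 0 := by simpa using hx
  obtain ⟨g', h, h1, h2⟩ := exists_hasFDerivAt_pow_euler l hx'
  have hs : HasFDerivAt (fun x : ℍ[ℝ] => star x) starCLM x := starCLM.hasFDerivAt
  refine ⟨_, HasFDerivAt.comp x h hs, by simpa [starCLM_apply] using h1, ?_⟩
  have e : (star x).im = -x.im := by ext <;> simp
  rw [e] at h2
  rw [← h2]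
  simp [starCLM_apply, inv_neg]

/-! ### Uniqueness of the inducing stem function -/

theorem orderedProd_smul (K : Finset (Fin n)) (s : Fin n → ℝ) (J : Fin n → ℍ[ℝ]) :
    orderedProd K (fun k => s k • J k) = (∏ k, if k ∈ K then s k else 1) • orderedProd K J := by
  rw [orderedProd_eq, orderedProd_eq, ← MultilinearMap.map_smul_univ]
  congr 1
  ext1 k
  split_ifs <;> simp

theorem orderedProd_ne_zero (K : Finset (Fin n)) {J : Fin n → ℍ[ℝ]} (hJ : ∀ k, J k ≠ 0) :
    orderedProd K J ≠ 0 := by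
  rw [orderedProd]
  refine List.prod_ne_zero fun h => ?_
  obtain ⟨k, hk⟩ := (List.mem_ofFn' _ _).1 h
  by_cases hkK : k ∈ K
  · exact hJ k (by simpa [hkK] using hk)
  · simp [hkK] at hk

/-- Orthogonality of the characters of `{±1}ⁿ`: the sum factors as `∏ (1 + c_k)`, with `c_k = 1`
when `H` and `K` agree at `k` and `c_k = -1` otherwise. -/
theorem sum_signs (H K : Finset (Fin n)) :
    ∑ S : Finset (Fin n), (∏ k, if k ∈ H then (if k ∈ S then (-1 : ℝ) else 1) else 1) *
        (∏ k, if k ∈ K then (if k ∈ S then (-1 : ℝ) else 1) else 1)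
      = if H = K then 2 ^ n else 0 := by
  have h (S : Finset (Fin n)) :
      (∏ k, if k ∈ H then (if k ∈ S then (-1 : ℝ) else 1) else 1) *
        (∏ k, if k ∈ K then (if k ∈ S then (-1 : ℝ) else 1) else 1)
      = ∏ k ∈ S, (if (k ∈ H ↔ k ∈ K) then (1 : ℝ) else -1) := by
    rw [← Finset.prod_mul_distrib, ← Finset.prod_subset (Finset.subset_univ S)]
    · refine Finset.prod_congr rfl fun k hk => ?_
      by_cases h1 : k ∈ H <;> by_cases h2 : k ∈ K <;> simp [h1, h2, hk]
    · intro k _ hk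
      simp [hk]
  simp only [h]
  rw [← Finset.powerset_univ, ← Finset.prod_one_add]
  split_ifs with hHK
  · subst hHK
    norm_num
  · obtain ⟨k, hk⟩ : ∃ k, ¬ (k ∈ H ↔ k ∈ K) := by
      by_contra! h
      exact hHK (Finset.ext h)
    exact Finset.prod_eq_zero (Finset.mem_univ k) (by simp [hk])

/-- The choices `J_k = ±i` suffice: they multiply the `K`-th term by a character, and Fourier
inversion over the signs isolates each term. -/
theorem eq_zero_of_sum_orderedProd_eq_zero {a : Finset (Fin n) → ℍ[ℝ]}
    (h : ∀ J : Fin n → ℍ[ℝ], (∀ k, J k * J k = -1) → ∑ K, orderedProd K J * a K = 0) : a = 0 := by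
  have hqi : qi * qi = -1 := by ext <;> simp
  have hqi0 : qi ≠ 0 := fun h => by simpa using congrArg (·.imI) h
  funext H
  let s (S : Finset (Fin n)) (k : Fin n) : ℝ := if k ∈ S then -1 else 1
  have hs (S : Finset (Fin n)) :
      ∑ K, (∏ k, if k ∈ K then s S k else 1) • (orderedProd K (fun _ => qi) * a K) = 0 := by
    simp only [← smul_mul_assoc, ← orderedProd_smul]
    refine h _ fun k => ?_
    by_cases hk : k ∈ S <;> simp [s, hk, hqi]
  have h2 : ∑ S, (∏ k, if k ∈ H then s S k else 1) •
      ∑ K, (∏ k, if k ∈ K then s S k else 1) • (orderedProd K (fun _ => qi) * a K) = 0 :=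
    Finset.sum_eq_zero fun S _ => by rw [hs, smul_zero]
  simp only [Finset.smul_sum, smul_smul] at h2
  rw [Finset.sum_comm] at h2
  simp only [← Finset.sum_smul, s, sum_signs] at h2
  simpa [orderedProd_ne_zero H fun _ => hqi0] using h2

theorem Induces.unique {F₁ F₂ : (Fin n → ℂ) → Finset (Fin n) → ℍ[ℝ]} {f : (Fin n → ℍ[ℝ]) → ℍ[ℝ]}
    (h₁ : Induces F₁ f) (h₂ : Induces F₂ f) : F₁ = F₂ := by
  funext z
  rw [← sub_eq_zero]
  refine eq_zero_of_sum_orderedProd_eq_zero fun J hJ => ?_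
  simp only [Pi.sub_apply, mul_sub, Finset.sum_sub_distrib]
  rw [← h₁ z J hJ, ← h₂ z J hJ, sub_self]

/-! ### Products of one-variable stem functions -/

/-- `g(α + Jβ) = Re φ(α + iβ) + J Im φ(α + iβ)` for every imaginary unit `J`. -/
def IsSliceExt (φ : ℂ → ℂ) (g : ℍ[ℝ] → ℍ[ℝ]) : Prop :=
  ∀ (z : ℂ) (J : ℍ[ℝ]), J * J = -1 →
    g ((z.re : ℍ[ℝ]) + J * (z.im : ℍ[ℝ])) = ((φ z).re : ℍ[ℝ]) + J * ((φ z).im : ℍ[ℝ])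

/-- The real or imaginary part of `w`, according to whether `k ∈ K`. -/
def part (K : Finset (Fin n)) (k : Fin n) (w : ℂ) : ℝ := if k ∈ K then w.im else w.re

/-- The stem function with components `∏_{k ∈ K} Im φ_k(z_k) ∏_{k ∉ K} Re φ_k(z_k)`. -/
def prodStem (φ : Fin n → ℂ → ℂ) (z : Fin n → ℂ) (K : Finset (Fin n)) : ℍ[ℝ] :=
  ((∏ k, part K k (φ k (z k)) : ℝ) : ℍ[ℝ])

/-- Expand `∏ (Re φ_k + J_k Im φ_k)` by multilinearity; the real parts and imaginary parts commute
with every `J_k`. -/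
theorem prodStem_induces {φ : Fin n → ℂ → ℂ} {g : Fin n → ℍ[ℝ] → ℍ[ℝ]}
    (h : ∀ k, IsSliceExt (φ k) (g k)) :
    Induces (prodStem φ) (fun x => oprod n fun k => g k (x k)) := by
  intro z J hJ
  have e (K : Finset (Fin n)) : orderedProd K J * prodStem φ z K
      = oprod n fun k => if k ∈ K then J k * ((φ k (z k)).im : ℍ[ℝ])
          else ((φ k (z k)).re : ℍ[ℝ]) := by
    rw [orderedProd_eq, prodStem, ← oprod_coe, oprod_mul]
    · congr 1
      ext1 k
      by_cases hk : k ∈ K <;> simp [part, hk]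
    · exact fun i j _ => commute_of_eq_coe rfl _
  simp only [e, sum_oprod_ite]
  congr 1
  ext1 k
  rw [h k _ _ (hJ k), add_comm]

theorem prodStem_isStem {φ : Fin n → ℂ → ℂ} (h : ∀ k z, φ k (star z) = star (φ k z)) :
    IsStem (prodStem φ) := by
  intro z K p
  have e (k : Fin n) : part K k (φ k (Function.update z p (star (z p)) k))
      = (if k = p then (if p ∈ K then (-1 : ℝ) else 1) else 1) * part K k (φ k (z k)) := by
    by_cases hk : k = p
    · subst hk
      rw [Function.update_self, h]
      by_cases hK : k ∈ K <;> simp [part, hK]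
    · simp [hk]
  rw [prodStem, Finset.prod_congr rfl fun k _ => e k, Finset.prod_mul_distrib]
  by_cases hK : p ∈ K <;> simp [hK, prodStem]

theorem prodStem_contDiff {φ : Fin n → ℂ → ℂ} (h : ∀ k, ContDiff ℝ 1 (φ k)) :
    ContDiff ℝ 1 (prodStem φ) := by
  refine contDiff_pi.2 fun K => ?_
  have e : (fun z => prodStem φ z K) = fun z => (∏ k, part K k (φ k (z k))) • (1 : ℍ[ℝ]) := by
    funext z
    exact coe_eq_smul_one _
  rw [e]
  refine ContDiff.smul (f := fun z : Fin n → ℂ => ∏ k, part K k (φ k (z k))) (contDiff_prod fun k _ => ?_)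
    contDiff_const
  have hk : ContDiff ℝ 1 fun z : Fin n → ℂ => φ k (z k) := (h k).comp (contDiff_apply ℝ ℂ k)
  unfold part
  split_ifs
  · exact Complex.imCLM.contDiff.comp hk
  · exact Complex.reCLM.contDiff.comp hk

theorem prod_part_eq (K : Finset (Fin n)) (w : Fin n → ℂ) (p : Fin n) :
    ∏ k, part K k (w k) = part K p (w p) * ∏ k ∈ Finset.univ.erase p, part K k (w k) :=
  (Finset.mul_prod_erase _ _ (Finset.mem_univ p)).symm

theorem lineDeriv_prodStem {φ : Fin n → ℂ → ℂ} {p : Fin n} {z : Fin n → ℂ} {φ' : ℂ →L[ℝ] ℂ}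
    (h : HasFDerivAt (φ p) φ' (z p)) (u : ℂ) (K : Finset (Fin n)) :
    lineDeriv ℝ (prodStem φ) z (Pi.single p u) K
      = (part K p (φ' u) * ∏ k ∈ Finset.univ.erase p, part K k (φ k (z k))) • (1 : ℍ[ℝ]) := by
  have h1 : HasDerivAt (fun t : ℝ => φ p (z p + t • u)) (φ' u) 0 := by
    have h1 : HasDerivAt (fun t : ℝ => z p + t • u) u 0 := by
      simpa using ((hasDerivAt_id (0 : ℝ)).smul_const u).const_add (z p)
    exact HasFDerivAt.comp_hasDerivAt (0 : ℝ) (by simpa using h) h1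
  have h2 (K : Finset (Fin n)) :
      HasDerivAt (fun t : ℝ => part K p (φ p (z p + t • u))) (part K p (φ' u)) 0 := by
    unfold part
    split_ifs
    · exact Complex.imCLM.hasFDerivAt.comp_hasDerivAt (0 : ℝ) h1
    · exact Complex.reCLM.hasFDerivAt.comp_hasDerivAt (0 : ℝ) h1
  have e : (fun t : ℝ => prodStem φ (z + t • (Pi.single p u : Fin n → ℂ)))
      = fun t K => (part K p (φ p (z p + t • u)) *
          ∏ k ∈ Finset.univ.erase p, part K k (φ k (z k))) • (1 : ℍ[ℝ]) := by
    funext t K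
    rw [prodStem, prod_part_eq K _ p, coe_eq_smul_one]
    have e2 : ∀ k ∈ Finset.univ.erase p,
        part K k (φ k ((z + t • (Pi.single p u : Fin n → ℂ)) k)) = part K k (φ k (z k)) := by
      intro k hk
      simp [Finset.ne_of_mem_erase hk]
    rw [Finset.prod_congr rfl e2]
    simp
  rw [lineDeriv, e]
  have h3 := hasDerivAt_pi.2 fun K : Finset (Fin n) =>
    ((h2 K).mul_const (∏ k ∈ Finset.univ.erase p, part K k (φ k (z k)))).smul_const (1 : ℍ[ℝ])
  rw [h3.deriv]

theorem prodStem_update (φ : Fin n → ℂ → ℂ) (p : Fin n) (ψ : ℂ → ℂ) (z : Fin n → ℂ)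
    (K : Finset (Fin n)) :
    prodStem (Function.update φ p ψ) z K
      = (part K p (ψ (z p)) * ∏ k ∈ Finset.univ.erase p, part K k (φ k (z k))) • (1 : ℍ[ℝ]) := by
  have e : ∀ k ∈ Finset.univ.erase p, part K k (Function.update φ p ψ k (z k))
      = part K k (φ k (z k)) := by
    intro k hk
    simp [Finset.ne_of_mem_erase hk]
  rw [prodStem, prod_part_eq K _ p, Finset.prod_congr rfl e, coe_eq_smul_one]
  simp

theorem prod_erase_part_congr {K K' : Finset (Fin n)} {p : Fin n}
    (h : ∀ k, k ≠ p → (k ∈ K ↔ k ∈ K')) (w : Fin n → ℂ) :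
    ∏ k ∈ Finset.univ.erase p, part K k (w k) = ∏ k ∈ Finset.univ.erase p, part K' k (w k) :=
  Finset.prod_congr rfl fun k hk => by simp [part, h k (Finset.ne_of_mem_erase hk)]

/-- Toggling `p` in `K` swaps the real and imaginary parts of the `p`-th factor only, and the sign
in `𝒥_p` matches `Re(iw) = -Im w`, `Im(iw) = Re w`. -/
theorem cstruct_lineDeriv_prodStem {φ : Fin n → ℂ → ℂ} {p : Fin n} {z : Fin n → ℂ}
    {φ' : ℂ →L[ℝ] ℂ} (h : HasFDerivAt (φ p) φ' (z p)) (u : ℂ) (K : Finset (Fin n)) :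
    cstruct p (lineDeriv ℝ (prodStem φ) z (Pi.single p u)) K
      = (part K p (Complex.I * φ' u) * ∏ k ∈ Finset.univ.erase p, part K k (φ k (z k)))
        • (1 : ℍ[ℝ]) := by
  rw [cstruct]
  split_ifs with hK
  · rw [lineDeriv_prodStem h, prod_erase_part_congr (K := K.erase p) (K' := K)]
    · simp [part, hK]
    · intro k hk; simp [hk]
  · rw [lineDeriv_prodStem h, prod_erase_part_congr (K := insert p K) (K' := K)]
    · simp [part, hK]
    · intro k hk; simp [hk]

theorem part_add (K : Finset (Fin n)) (k : Fin n) (a b : ℂ) :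
    part K k (a + b) = part K k a + part K k b := by
  unfold part; split_ifs <;> simp

theorem part_sub (K : Finset (Fin n)) (k : Fin n) (a b : ℂ) :
    part K k (a - b) = part K k a - part K k b := by
  unfold part; split_ifs <;> simp

theorem part_smul (K : Finset (Fin n)) (k : Fin n) (c : ℝ) (a : ℂ) :
    part K k (c • a) = c * part K k a := by
  unfold part; split_ifs <;> simp

theorem stemD_prodStem {φ : Fin n → ℂ → ℂ} {p : Fin n} {φ' : ℂ → ℂ →L[ℝ] ℂ}
    (h : ∀ z, HasFDerivAt (φ p) (φ' z) z) :
    stemD p (prodStem φ) = prodStem (Function.update φ p fun z =>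
      (1 / 2 : ℝ) • (φ' z 1 - Complex.I * φ' z Complex.I)) := by
  funext z K
  rw [prodStem_update, stemD, Pi.smul_apply, Pi.sub_apply, lineDeriv_prodStem (h _),
    cstruct_lineDeriv_prodStem (h _), part_smul, part_sub, ← sub_smul, smul_smul]
  ring_nf

theorem stemDBar_prodStem {φ : Fin n → ℂ → ℂ} {p : Fin n} {φ' : ℂ → ℂ →L[ℝ] ℂ}
    (h : ∀ z, HasFDerivAt (φ p) (φ' z) z) :
    stemDBar p (prodStem φ) = prodStem (Function.update φ p fun z =>
      (1 / 2 : ℝ) • (φ' z 1 + Complex.I * φ' z Complex.I)) := by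
  funext z K
  rw [prodStem_update, stemDBar, Pi.smul_apply, Pi.add_apply, lineDeriv_prodStem (h _),
    cstruct_lineDeriv_prodStem (h _), part_smul, part_add, ← add_smul, smul_smul]
  ring_nf

section Products

variable {φ : Fin n → ℂ → ℂ} {g : Fin n → ℍ[ℝ] → ℍ[ℝ]} {p : Fin n} {φ' : ℂ → ℂ →L[ℝ] ℂ}
  {ψ : ℂ → ℂ} {d : ℍ[ℝ] → ℍ[ℝ]}

theorem prodStem_update_induces (hg : ∀ k, IsSliceExt (φ k) (g k)) (hd : IsSliceExt ψ d) :
    Induces (prodStem (Function.update φ p ψ))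
      (fun x => oprod n (Function.update (fun k => g k (x k)) p (d (x p)))) := by
  have h : ∀ k, IsSliceExt (Function.update φ p ψ k) (Function.update g p d k) := by
    intro k
    by_cases hk : k = p
    · subst hk; simpa using hd
    · simpa [hk] using hg k
  convert prodStem_induces h using 3
  ext1 k
  by_cases hk : k = p
  · subst hk; simp
  · simp [hk]

theorem hasSlicePD_oprod (hφ : ∀ k, ContDiff ℝ 1 (φ k)) (hs : ∀ k z, φ k (star z) = star (φ k z))
    (hg : ∀ k, IsSliceExt (φ k) (g k)) (h : ∀ z, HasFDerivAt (φ p) (φ' z) z)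
    (hψ : ∀ z, (1 / 2 : ℝ) • (φ' z 1 - Complex.I * φ' z Complex.I) = ψ z)
    (hd : IsSliceExt ψ d) :
    HasSlicePD p (fun x => oprod n fun k => g k (x k))
      (fun x => oprod n (Function.update (fun k => g k (x k)) p (d (x p)))) := by
  refine ⟨⟨_, prodStem_isStem hs, prodStem_contDiff hφ, prodStem_induces hg⟩, fun F _ _ hF => ?_⟩
  rw [hF.unique (prodStem_induces hg), stemD_prodStem h, funext hψ]
  exact prodStem_update_induces hg hd

theorem hasSlicePDConj_oprod (hφ : ∀ k, ContDiff ℝ 1 (φ k))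
    (hs : ∀ k z, φ k (star z) = star (φ k z))
    (hg : ∀ k, IsSliceExt (φ k) (g k)) (h : ∀ z, HasFDerivAt (φ p) (φ' z) z)
    (hψ : ∀ z, (1 / 2 : ℝ) • (φ' z 1 + Complex.I * φ' z Complex.I) = ψ z)
    (hd : IsSliceExt ψ d) :
    HasSlicePDConj p (fun x => oprod n fun k => g k (x k))
      (fun x => oprod n (Function.update (fun k => g k (x k)) p (d (x p)))) := by
  refine ⟨⟨_, prodStem_isStem hs, prodStem_contDiff hφ, prodStem_induces hg⟩, fun F _ _ hF => ?_⟩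
  rw [hF.unique (prodStem_induces hg), stemDBar_prodStem h, funext hψ]
  exact prodStem_update_induces hg hd

end Products

/-! ### Monomials -/

/-- For fixed `J` with `J² = -1`, the real span of `1` and `J` multiplies like `ℂ`. -/
theorem IsSliceExt.mul {φ ψ : ℂ → ℂ} {g d : ℍ[ℝ] → ℍ[ℝ]} (hg : IsSliceExt φ g)
    (hd : IsSliceExt ψ d) : IsSliceExt (fun z => φ z * ψ z) (fun x => g x * d x) := by
  intro z J hJ
  simp only [hg z J hJ, hd z J hJ, Complex.mul_re, Complex.mul_im]
  generalize (φ z).re = a, (φ z).im = b, (ψ z).re = a', (ψ z).im = b'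
  have e (s t : ℝ) : (s : ℍ[ℝ]) + J * t = s • 1 + t • J := by
    rw [← Quaternion.coe_commutes, Quaternion.coe_mul_eq_smul, coe_eq_smul_one]
  simp only [e, mul_add, add_mul, smul_mul_smul_comm, hJ, one_mul, mul_one]
  module

theorem isSliceExt_const (c : ℝ) : IsSliceExt (fun _ => c) (fun _ => (c : ℍ[ℝ])) := by
  intro z J _
  simp

theorem IsSliceExt.pow {φ : ℂ → ℂ} {g : ℍ[ℝ] → ℍ[ℝ]} (hg : IsSliceExt φ g) (l : ℕ) :
    IsSliceExt (fun z => φ z ^ l) (fun x => g x ^ l) := by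
  induction l with
  | zero => simpa using isSliceExt_const 1
  | succ l ih =>
    simp only [pow_succ]
    exact ih.mul hg

theorem isSliceExt_id : IsSliceExt (fun z => z) (fun x => x) := fun _ _ _ => rfl

theorem star_eq_neg_of_mul_self {J : ℍ[ℝ]} (hJ : J * J = -1) : star J = -J := by
  have h0 := congrArg (·.re) hJ
  have h1 := congrArg (·.imI) hJ
  have h2 := congrArg (·.imJ) hJ
  have h3 := congrArg (·.imK) hJ
  simp at h0 h1 h2 h3
  have hre : J.re = 0 := by
    -- The imaginary coordinates of `J * J` are `2 J₀ J_a = 0`; if `J₀ ≠ 0` then `J` is real and its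
    -- square cannot be `-1`.
    by_contra hne
    have e1 : J.imI = 0 := mul_left_cancel₀ hne (by linarith)
    have e2 : J.imJ = 0 := mul_left_cancel₀ hne (by linarith)
    have e3 : J.imK = 0 := mul_left_cancel₀ hne (by linarith)
    rw [e1, e2, e3] at h0
    nlinarith [sq_nonneg J.re]
  ext <;> simp [hre]

theorem isSliceExt_star : IsSliceExt (fun z => star z) (fun x => star x) := by
  intro z J hJ
  beta_reduce
  rw [star_add, star_mul, star_eq_neg_of_mul_self hJ]
  simp [Quaternion.coe_commutes]

theorem isSliceExt_natCast_mul_pow {φ : ℂ → ℂ} {g : ℍ[ℝ] → ℍ[ℝ]} (hg : IsSliceExt φ g) (l : ℕ) :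
    IsSliceExt (fun z => l * φ z ^ (l - 1)) (fun x => (l : ℍ[ℝ]) * g x ^ (l - 1)) := by
  simpa [Quaternion.coe_natCast] using (isSliceExt_const (l : ℝ)).mul (hg.pow (l - 1))

theorem hasFDerivAt_cpow (l : ℕ) (z : ℂ) :
    HasFDerivAt (fun z : ℂ => z ^ l)
      ((l * z ^ (l - 1)) • (ContinuousLinearMap.id ℝ ℂ)) z := by
  refine ((hasDerivAt_pow l z).hasFDerivAt.restrictScalars ℝ).congr_fderiv ?_
  ext w
  all_goals simp [mul_comm]

theorem hasFDerivAt_star_cpow (l : ℕ) (z : ℂ) :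
    HasFDerivAt (fun z : ℂ => star z ^ l)
      ((l * star z ^ (l - 1)) • (Complex.conjCLE : ℂ →L[ℝ] ℂ)) z :=
  HasFDerivAt.comp z (hasFDerivAt_cpow l (star z)) Complex.conjCLE.hasFDerivAt

/-- The scalar `l m` is central. When `l m = 0` the truncated exponents are harmless, as both sides
carry the factor `0`. -/
theorem oprod_update_natCast_mul (l : Fin n → ℕ) (m : Fin n) (x : Fin n → ℍ[ℝ]) :
    oprod n (Function.update (fun k => x k ^ l k) m ((l m : ℍ[ℝ]) * x m ^ (l m - 1)))
      = (l m : ℍ[ℝ]) * monom (l - Pi.single m 1) x := by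
  have e : (l m : ℍ[ℝ]) = ((l m : ℝ) : ℍ[ℝ]) := (Quaternion.coe_natCast _).symm
  rw [e, Quaternion.coe_mul_eq_smul, Quaternion.coe_mul_eq_smul, MultilinearMap.map_update_smul,
    monom, ← oprod_apply]
  congr 2
  ext1 k
  by_cases hk : k = m
  · subst hk; simp
  · simp [hk]

end QWirtinger

end

open QWirtinger in
theorem mainTheorem3 (n : ℕ) (l : Fin n → ℕ) (m : Fin n) :
    ((∀ x ∈ QWirtinger.nonreal n,
          QWirtinger.theta m (QWirtinger.monom l) x
            = (l m : ℍ[ℝ]) * QWirtinger.monom (l - Pi.single m 1) x) ∧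
      QWirtinger.HasSlicePD m (QWirtinger.monom l)
        (fun x => (l m : ℍ[ℝ]) * QWirtinger.monom (l - Pi.single m 1) x)) ∧
    ((∀ x ∈ QWirtinger.nonreal n, QWirtinger.thetaBar m (QWirtinger.monom l) x = 0) ∧
      QWirtinger.HasSlicePDConj m (QWirtinger.monom l) (fun _ => 0)) ∧
    ((∀ x ∈ QWirtinger.nonreal n, QWirtinger.theta m (QWirtinger.conjMonom l) x = 0) ∧
      QWirtinger.HasSlicePD m (QWirtinger.conjMonom l) (fun _ => 0)) ∧
    ((∀ x ∈ QWirtinger.nonreal n,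
          QWirtinger.thetaBar m (QWirtinger.conjMonom l) x
            = (l m : ℍ[ℝ]) * QWirtinger.conjMonom (l - Pi.single m 1) x) ∧
      QWirtinger.HasSlicePDConj m (QWirtinger.conjMonom l)
        (fun x => (l m : ℍ[ℝ]) * QWirtinger.conjMonom (l - Pi.single m 1) x)) := by
  have hm : monom l = fun x => oprod n fun k => x k ^ l k := funext fun x => (oprod_apply _).symm
  have hc : conjMonom l = fun x => oprod n fun k => star (x k) ^ l k :=
    funext fun x => (oprod_apply _).symm
  have hconj (x : Fin n → ℍ[ℝ]) : conjMonom (l - Pi.single m 1) x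
      = monom (l - Pi.single m 1) (fun k => star (x k)) := rfl
  have hzero (a : Fin n → ℍ[ℝ]) : oprod n (Function.update a m 0) = 0 :=
    (oprod n).map_update_zero a m
  -- Each nonzero right-hand side becomes the original product with its `m`-th factor replaced, the
  -- form in which both kinds of derivative are computed.
  simp only [hconj, ← oprod_update_natCast_mul]
  rw [hm, hc]
  choose U V hg using fun k => exists_isSliceFn_pow (l k)
  choose U' V' hg' using fun k => exists_isSliceFn_star_pow (l k)
  have hφ (k : Fin n) : ContDiff ℝ 1 fun z : ℂ => z ^ l k := contDiff_id.pow _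
  have hφ' (k : Fin n) : ContDiff ℝ 1 fun z : ℂ => star z ^ l k :=
    ContDiff.pow Complex.conjCLE.contDiff _
  have hs (k : Fin n) (z : ℂ) : star z ^ l k = star (z ^ l k) := (star_pow z _).symm
  have hs' (k : Fin n) (z : ℂ) : star (star z) ^ l k = star (star z ^ l k) := (star_pow _ _).symm
  have he (k : Fin n) := isSliceExt_id.pow (l k)
  have he' (k : Fin n) := isSliceExt_star.pow (l k)
  have h0 : IsSliceExt (fun _ => 0) (fun _ => 0) := by simpa using isSliceExt_const 0
  -- For `z ^ l` the derivative along `I` is `a * I`, for `z̄ ^ l` it is `-(a * I)`, where `a` is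
  -- the derivative along `1`; this identity decides which Wirtinger derivative vanishes.
  have hI (a : ℂ) : Complex.I * (a * Complex.I) = -a := by
    linear_combination a * Complex.I_mul_I
  refine ⟨⟨fun x hx => ?_, ?_⟩, ⟨fun x hx => ?_, ?_⟩, ⟨fun x hx => ?_, ?_⟩, ⟨fun x hx => ?_, ?_⟩⟩
  · obtain ⟨g', h, h1, h2⟩ := exists_hasFDerivAt_pow_euler (l m) (hx m)
    rw [theta_oprod hg m hx h, h1, h2, ← two_smul ℝ, smul_smul]
    norm_num
  · exact hasSlicePD_oprod hφ hs he (hasFDerivAt_cpow (l m))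
      (fun z => by simp [hI]; ring) (isSliceExt_natCast_mul_pow isSliceExt_id (l m))
  · obtain ⟨g', h, h1, h2⟩ := exists_hasFDerivAt_pow_euler (l m) (hx m)
    rw [thetaBar_oprod hg m hx h, h1, h2, sub_self, smul_zero, hzero]
  · simpa only [hzero] using hasSlicePDConj_oprod hφ hs he (hasFDerivAt_cpow (l m))
      (fun z => by simp [hI]) h0
  · obtain ⟨g', h, h1, h2⟩ := exists_hasFDerivAt_star_pow_euler (l m) (hx m)
    rw [theta_oprod hg' m hx h, h1, h2, add_neg_cancel, smul_zero, hzero]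
  · simpa only [hzero] using hasSlicePD_oprod hφ' hs' he' (hasFDerivAt_star_cpow (l m))
      (fun z => by simp [hI]) h0
  · obtain ⟨g', h, h1, h2⟩ := exists_hasFDerivAt_star_pow_euler (l m) (hx m)
    rw [thetaBar_oprod hg' m hx h, h1, h2, sub_neg_eq_add, ← two_smul ℝ, smul_smul]
    norm_num
  · exact hasSlicePDConj_oprod hφ' hs' he' (hasFDerivAt_star_cpow (l m))
      (fun z => by simp [hI]; ring) (isSliceExt_natCast_mul_pow isSliceExt_star (l m))
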